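/- Let $p > 2$ be a prime and let $G$ be a finite nonabelian $p$-group containing a cyclic subgroup of index $p^2$. Let $G'$ denote the commutator subgroup of $G$ and $d(G)$ the minimal number of generators of $G$. Then $G$ satisfies at least one of the following three conditions: (a) $G$ is metacyclic, that is, $G$ has a cyclic normal subgroup $N$ such that $G/N$ is cyclic; (b) $|G'| = p$; (c) $G'$ is elementary abelian of order $p^2$ and $d(G) = 2$. -/

import Mathlib

/-- A group is metacyclic if it has a cyclic normal subgroup with cyclic quotient. -/
def IsMetacyclic (G : Type*) [Group G] : Prop :=
  ∃ (N : Subgroup G) (_ : N.Normal), IsCyclic N ∧ IsCyclic (G ⧸ N)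

/-- An elementary abelian `p`-group (for a prime `p`): an abelian group
in which every element satisfies `x ^ p = 1`. -/
def IsElementaryAbelian (p : ℕ) (A : Type*) [Group A] : Prop :=
  (∀ x y : A, x * y = y * x) ∧ ∀ x : A, x ^ p = 1

/-! Let `⟨c⟩` be the cyclic subgroup of index `p ^ 2`, of order at least `p ^ 2` (otherwise `G` has
order at most `p ^ 3`), and let `M` be a subgroup of index `p` containing it. If `M` is cyclic, `G`
is metacyclic. Otherwise `M = ⟨c, b⟩` with `b ^ p = 1` and `[b, c]` in the subgroup `⟨z⟩` of order
`p` of `⟨c⟩` (`exists_complement_of_index_prime`). Take `g` outside `M`. Then `z` is central in `G`,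
`b` is central modulo `⟨z⟩`, and `g c g⁻¹ = c η` with `η = c ^ (p k) b ^ j`.

If `p ∣ j`, then `⟨c⟩` is normal. Either its quotient is cyclic, or `g ^ p ∈ ⟨c⟩`; then `g` acts on
`⟨c⟩` with order dividing `p`, so `[g, c] ∈ ⟨z⟩` and `|G'| = p`.

If `p ∤ j`, then `G = ⟨c, g⟩` and `G' ≤ ⟨η⟩⟨z⟩` (`exists_of_mem_commutator`). When `η ^ p = 1` this
gives (b) or (c). When `η ^ p ≠ 1`, it generates `⟨z⟩`, and some `y = g c ^ u` has `y ^ p` equal to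
a generator of `⟨η⟩` modulo `⟨z⟩`. Hence `⟨y⟩` contains `G'`, and `G/⟨y⟩` is generated by the image
of `c` (`isMetacyclic_of_pow_ne_one`). -/

/-! ### Power and conjugation formulas with central commutators -/

lemma pow_mul_eq_of_commutator {G : Type*} [Group G] {x y w : G} (h : y * x = x * y * w)
    (hy : Commute w y) (n : ℕ) : y ^ n * x = x * y ^ n * w ^ n := by
  induction n with
  | zero => simp
  | succ n ih =>
    calc y ^ (n + 1) * x = y ^ n * (y * x) := by rw [pow_succ, mul_assoc]
      _ = (y ^ n * x) * (y * w) := by rw [h]; group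
      _ = x * y ^ n * (w ^ n * y) * w := by rw [ih]; group
      _ = x * y ^ n * (y * w ^ n) * w := by rw [(hy.pow_left n).eq]
      _ = x * y ^ (n + 1) * w ^ (n + 1) := by rw [pow_succ, pow_succ]; group

lemma mul_pow_of_commutator {G : Type*} [Group G] {x y w : G} (h : y * x = x * y * w)
    (hx : Commute w x) (hy : Commute w y) (n : ℕ) :
    (x * y) ^ n = x ^ n * y ^ n * w ^ n.choose 2 := by
  induction n with
  | zero => simp
  | succ n ih =>
    have hxy : Commute (w ^ n.choose 2) (x * y) := (hx.mul_right hy).pow_left _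
    calc (x * y) ^ (n + 1) = x ^ n * y ^ n * (w ^ n.choose 2 * (x * y)) := by
          rw [pow_succ, ih, mul_assoc]
      _ = x ^ n * (y ^ n * x) * y * w ^ n.choose 2 := by rw [hxy.eq]; group
      _ = x ^ n * x * y ^ n * (w ^ n * y) * w ^ n.choose 2 := by
          rw [pow_mul_eq_of_commutator h hy]; group
      _ = x ^ (n + 1) * y ^ (n + 1) * w ^ (n + 1).choose 2 := by
          rw [(hy.pow_left n).eq, Nat.choose_succ_succ' n 1, Nat.choose_one_right, pow_add,
            pow_succ, pow_succ]
          group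

lemma pow_choose_two_eq_one {G : Type*} [Group G] {p : ℕ} (hp2 : Odd p) {w : G}
    (hw : w ^ p = 1) : w ^ p.choose 2 = 1 := by
  obtain ⟨k, rfl⟩ := hp2
  have : (2 * k + 1).choose 2 = (2 * k + 1) * k := by
    rw [Nat.choose_two_right]
    apply Nat.div_eq_of_eq_mul_left (by norm_num)
    simp; ring
  rw [this, pow_mul, hw, one_pow]

/-- For odd `p` the correction exponent `p.choose 2` is a multiple of `p`, so `w` disappears. This
is where oddness enters the group theory. -/
lemma mul_pow_prime_of_commutator {G : Type*} [Group G] {p : ℕ} (hp2 : Odd p) {x y w : G}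
    (h : y * x = x * y * w) (hx : Commute w x) (hy : Commute w y) (hw : w ^ p = 1) :
    (x * y) ^ p = x ^ p * y ^ p := by
  rw [mul_pow_of_commutator h hx hy, pow_choose_two_eq_one hp2 hw, mul_one]

/-- The factors stay in the order `c`, `h`, `w` throughout, so `c` and `h` need not commute. -/
lemma conj_pow_of_conj {G : Type*} [Group G] {g c h w : G} (hc : g * c * g⁻¹ = c * h)
    (hh : g * h * g⁻¹ = h * w) (hg : Commute w g) (hwh : Commute w h) (n : ℕ) :
    g ^ n * c * (g ^ n)⁻¹ = c * h ^ n * w ^ n.choose 2 := by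
  induction n with
  | zero => simp
  | succ n ih =>
    have h1 : g * w ^ n.choose 2 * g⁻¹ = w ^ n.choose 2 := by
      rw [← (hg.pow_left _).eq]; group
    have h2 : g * h ^ n * g⁻¹ = h ^ n * w ^ n := by
      rw [← conj_pow, hh, hwh.symm.mul_pow]
    calc g ^ (n + 1) * c * (g ^ (n + 1))⁻¹ = g * (g ^ n * c * (g ^ n)⁻¹) * g⁻¹ := by
          rw [pow_succ']; group
      _ = (g * c * g⁻¹) * (g * h ^ n * g⁻¹) * (g * w ^ n.choose 2 * g⁻¹) := by rw [ih]; group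
      _ = c * h ^ (n + 1) * w ^ (n + 1).choose 2 := by
          rw [hc, h2, h1, Nat.choose_succ_succ' n 1, Nat.choose_one_right, pow_add, pow_succ']
          group

lemma conj_pow_eq_zpow_pow {G : Type*} [Group G] {x c : G} {i : ℤ} (h : x * c * x⁻¹ = c ^ i)
    (k : ℕ) : x ^ k * c * (x ^ k)⁻¹ = c ^ (i ^ k) := by
  induction k with
  | zero => simp
  | succ k ih =>
    calc x ^ (k + 1) * c * (x ^ (k + 1))⁻¹ = x ^ k * (x * c * x⁻¹) * (x ^ k)⁻¹ := by
          rw [pow_succ]; group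
      _ = (x ^ k * c * (x ^ k)⁻¹) ^ i := by rw [h, conj_zpow]
      _ = c ^ (i ^ (k + 1)) := by rw [ih, ← zpow_mul, pow_succ]

/-! ### Action of `p`-elements on cyclic `p`-groups -/

lemma Int.prime_dvd_sub_one_of_dvd_pow_prime_pow_sub_one {p : ℕ} (hp : p.Prime) {i : ℤ} {n : ℕ}
    (h : (p : ℤ) ∣ i ^ p ^ n - 1) : (p : ℤ) ∣ i - 1 := by
  have := Fact.mk hp
  rw [← ZMod.intCast_zmod_eq_zero_iff_dvd] at h ⊢
  push_cast at h ⊢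
  rwa [ZMod.pow_card_pow] at h

/-- Lifting the exponent: once `p ∣ i - 1`, which Fermat gives, the valuation of `i ^ p - 1` exceeds
that of `i - 1` by exactly one. -/
lemma Int.prime_pow_dvd_sub_one_of_dvd_pow_sub_one {p : ℕ} (hp : p.Prime) (hp2 : Odd p) {i : ℤ}
    {m : ℕ} (h : (p : ℤ) ^ (m + 1) ∣ i ^ p - 1) : (p : ℤ) ^ m ∣ i - 1 := by
  have hp1 : (p : ℤ) ∣ i - 1 := by
    apply Int.prime_dvd_sub_one_of_dvd_pow_prime_pow_sub_one hp (n := 1)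
    rw [pow_one]
    exact (dvd_pow_self _ (Nat.succ_ne_zero m)).trans h
  have hpi : ¬ (p : ℤ) ∣ i := by
    intro hi
    have : (p : ℤ) ∣ 1 := by simpa using dvd_sub hi hp1
    exact (Nat.prime_iff_prime_int.1 hp).not_dvd_one this
  have hl := Int.emultiplicity_pow_sub_pow hp hp2 (y := 1) hp1 hpi p
  rw [one_pow] at hl
  rw [pow_dvd_iff_le_emultiplicity, hl] at h
  rw [pow_dvd_iff_le_emultiplicity]
  have h1 : emultiplicity p p = 1 :=
    (Nat.finiteMultiplicity_iff.2 ⟨hp.ne_one, hp.pos⟩).emultiplicity_self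
  rw [h1] at h
  push_cast at h
  exact (ENat.add_le_add_iff_right (by simp)).1 h

/-- An automorphism of order dividing `p` of a cyclic group of order `p ^ (m + 1)`, `p` odd, is
trivial modulo the subgroup generated by `c ^ p ^ m`. -/
lemma conj_eq_mul_zpow_of_commute_pow {G : Type*} [Group G] {p : ℕ} (hp : p.Prime)
    (hp2 : Odd p) {x c : G} {m : ℕ} (hc : orderOf c = p ^ (m + 1)) {i : ℤ}
    (h : x * c * x⁻¹ = c ^ i) (hx : Commute (x ^ p) c) :
    ∃ a : ℤ, x * c * x⁻¹ = c * (c ^ p ^ m) ^ a := by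
  have h1 := conj_pow_eq_zpow_pow h p
  rw [hx.eq, mul_inv_cancel_right] at h1
  have h2 : c ^ (i ^ p - 1) = 1 := by rw [zpow_sub_one, ← h1, mul_inv_cancel]
  rw [← orderOf_dvd_iff_zpow_eq_one, hc] at h2
  push_cast at h2
  obtain ⟨a, ha⟩ := Int.prime_pow_dvd_sub_one_of_dvd_pow_sub_one hp hp2 h2
  refine ⟨a, ?_⟩
  rw [h, ← zpow_natCast c, ← zpow_mul, ← zpow_one_add]
  congr 1
  push_cast
  linarith

/-- A `p`-element acting on a group of order `p` acts trivially. -/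
lemma IsPGroup.dvd_sub_one_of_conj {G : Type*} [Group G] {p : ℕ} (hp : p.Prime)
    (hG : IsPGroup p G) {x g : G} (hx1 : x ≠ 1) (hx : x ^ p = 1) {j : ℤ}
    (h : g * x * g⁻¹ = x ^ j) : (p : ℤ) ∣ j - 1 := by
  obtain ⟨n, hn⟩ := hG g
  have h1 := conj_pow_eq_zpow_pow h (p ^ n)
  rw [hn] at h1
  have h2 : x ^ (j ^ p ^ n - 1) = 1 := by rw [zpow_sub_one, ← h1]; group
  have ho : orderOf x = p := by
    have := Fact.mk hp
    exact orderOf_eq_prime hx hx1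
  rw [← orderOf_dvd_iff_zpow_eq_one, ho] at h2
  exact Int.prime_dvd_sub_one_of_dvd_pow_prime_pow_sub_one hp h2

/-! ### Subgroups of prime index -/

lemma zpow_mem_of_isCoprime {G : Type*} [Group G] {H : Subgroup G} {x : G} {i j : ℤ}
    (hij : IsCoprime i j) (hi : x ^ i ∈ H) (hj : x ^ j ∈ H) : x ∈ H := by
  obtain ⟨a, b, hab⟩ := hij
  have : x = (x ^ i) ^ a * (x ^ j) ^ b := by
    rw [← zpow_mul, ← zpow_mul, ← zpow_add, mul_comm i, mul_comm j, hab, zpow_one]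
  rw [this]
  exact H.mul_mem (H.zpow_mem hi a) (H.zpow_mem hj b)

lemma Int.isCoprime_prime_of_not_dvd {p : ℕ} (hp : p.Prime) {i : ℤ} (h : ¬ (p : ℤ) ∣ i) :
    IsCoprime i p :=
  ((Nat.prime_iff_prime_int.1 hp).coprime_iff_not_dvd.2 h).symm

lemma Subgroup.exists_mul_zpow_of_index_prime {G : Type*} [Group G] {p : ℕ} (hp : p.Prime)
    {H : Subgroup G} [H.Normal] (hH : H.index = p) {b : G} (hb : b ∉ H) (x : G) :
    ∃ y ∈ H, ∃ j : ℤ, x = y * b ^ j := by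
  have := Fact.mk hp
  have h1 : (b : G ⧸ H) ≠ 1 := by rwa [Ne, QuotientGroup.eq_one_iff]
  have h2 : (x : G ⧸ H) ∈ Subgroup.zpowers (b : G ⧸ H) :=
    mem_zpowers_of_prime_card (p := p) hH h1
  obtain ⟨j, hj⟩ := h2
  refine ⟨x * (b ^ j)⁻¹, ?_, j, by group⟩
  simp only at hj
  rw [← QuotientGroup.eq_one_iff, QuotientGroup.mk_mul, QuotientGroup.mk_inv,
    QuotientGroup.mk_zpow, hj, mul_inv_cancel]

lemma Subgroup.pow_mem_of_index_prime {G : Type*} [Group G] {p : ℕ}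
    {H : Subgroup G} [H.Normal] (hH : H.index = p) (x : G) : x ^ p ∈ H :=
  hH ▸ H.pow_index_mem x

/-- Elements of a noncyclic `p`-group with a cyclic subgroup of prime index. -/
lemma exists_complement_of_index_prime {M : Type*} [Group M] [Finite M] {p : ℕ} (hp : p.Prime)
    (hp2 : Odd p) (hMc : ¬ IsCyclic M) {c : M} {m : ℕ}
    (hc : orderOf c = p ^ (m + 2)) (hi : (Subgroup.zpowers c).index = p) :
    ∃ b : M, b ∉ Subgroup.zpowers c ∧ b ^ p = 1 ∧
      (∃ a : ℤ, b * c * b⁻¹ = c * (c ^ p ^ (m + 1)) ^ a) ∧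
      ∀ x : M, ∃ i j : ℤ, x = c ^ i * b ^ j := by
  have := Fact.mk hp
  have hcard : Nat.card M = p ^ (m + 3) := by
    rw [← (Subgroup.zpowers c).card_mul_index, hi, Nat.card_zpowers, hc]; ring
  have hn : (Subgroup.zpowers c).Normal := by
    apply Subgroup.normal_of_index_eq_minFac_card
    rw [hi, hcard, hp.pow_minFac (by omega)]
  have hne : Subgroup.zpowers c ≠ ⊤ := by
    intro h; rw [h, Subgroup.index_top] at hi; exact hp.ne_one hi.symm
  obtain ⟨x, hx⟩ : ∃ x, x ∉ Subgroup.zpowers c := by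
    by_contra! h; exact hne (eq_top_iff.2 fun x _ => h x)
  have hxp := Subgroup.pow_mem_of_index_prime hi x
  obtain ⟨s, hs⟩ := Subgroup.mem_zpowers_iff.1 hxp
  obtain ⟨i, hxi⟩ := Subgroup.mem_zpowers_iff.1 (hn.conj_mem c (Subgroup.mem_zpowers c) x)
  have hcomm : Commute (x ^ p) c := by rw [← hs]; exact (Commute.refl c).zpow_left s
  obtain ⟨a, ha⟩ := conj_eq_mul_zpow_of_commute_pow hp hp2 hc hxi.symm hcomm
  set w := (c ^ p ^ (m + 1)) ^ a with hw
  have hwp : w ^ p = 1 := by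
    rw [hw, ← zpow_natCast, zpow_comm, zpow_natCast, ← pow_mul, ← pow_succ, ← hc,
      pow_orderOf_eq_one, one_zpow]
  have hwc : Commute w c := ((Commute.refl c).pow_left _).zpow_left _
  have hwx : Commute w x := by
    have : x * c ^ p ^ (m + 1) * x⁻¹ = c ^ p ^ (m + 1) := by
      rw [← conj_pow, ha, hwc.symm.mul_pow, pow_succ' p, pow_mul w, hwp, one_pow, mul_one]
    have h2 : Commute (c ^ p ^ (m + 1)) x := (mul_inv_eq_iff_eq_mul.1 this).symm
    exact h2.zpow_left a
  -- If `p ∤ s`, then `x ^ p = c ^ s` generates `⟨c⟩`, and `x` generates all of `M`.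
  have hps : (p : ℤ) ∣ s := by
    by_contra hps
    have hcx : c ∈ Subgroup.zpowers x := by
      apply zpow_mem_of_isCoprime (i := s) (j := (p ^ (m + 2) : ℕ))
      · push_cast
        exact (Int.isCoprime_prime_of_not_dvd hp hps).pow_right
      · rw [hs]; exact Subgroup.pow_mem _ (Subgroup.mem_zpowers x) _
      · rw [zpow_natCast, ← hc, pow_orderOf_eq_one]; exact Subgroup.one_mem _
    refine hMc ⟨x, fun y => ?_⟩
    obtain ⟨y', hy', j, rfl⟩ := Subgroup.exists_mul_zpow_of_index_prime hp hi hx y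
    exact Subgroup.mul_mem _ (Subgroup.zpowers_le.2 hcx hy')
      (Subgroup.zpow_mem _ (Subgroup.mem_zpowers x) _)
  obtain ⟨s', rfl⟩ := hps
  -- The complement is `x * c ^ (-s')`: the `p`-th power is multiplicative here, and `x ^ p = c ^ (p
  -- * s')`.
  have hb : x * c ^ (-s') ∉ Subgroup.zpowers c := by
    intro h
    exact hx ((Subgroup.mul_mem_cancel_right _
      (Subgroup.zpow_mem _ (Subgroup.mem_zpowers c) _)).1 h)
  have hxc : x * c ^ (-s') * x⁻¹ = c ^ (-s') * w ^ (-s') := by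
    rw [← conj_zpow, ha, hwc.symm.mul_zpow]
  refine ⟨x * c ^ (-s'), hb, ?_, ⟨a, ?_⟩, fun y => ?_⟩
  · have h0 : c ^ (-s') * x = x * c ^ (-s') * w ^ s' := by
      have h1 : x * c ^ (-s') = c ^ (-s') * w ^ (-s') * x := mul_inv_eq_iff_eq_mul.1 hxc
      rw [h1, mul_assoc, ← (hwx.zpow_left s').eq]; group
    rw [mul_pow_prime_of_commutator hp2 h0 (hwx.zpow_left _)
      ((hwc.zpow_left _).zpow_right _), ← hs, ← zpow_natCast, ← zpow_mul, ← zpow_add]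
    · rw [show (p : ℤ) * s' + -s' * p = 0 by ring, zpow_zero]
    · rw [← zpow_natCast, zpow_comm, zpow_natCast, hwp, one_zpow]
  · rw [← ha]; group
  · obtain ⟨y', hy', j, rfl⟩ := Subgroup.exists_mul_zpow_of_index_prime hp hi hb y
    obtain ⟨i, rfl⟩ := Subgroup.mem_zpowers_iff.1 hy'
    exact ⟨i, j, rfl⟩

/-! ### Commutators and normality checked on generators -/

lemma zpow_mul_zpow_of_commutator {G : Type*} [Group G] {x y w : G} (h : y * x = x * y * w)
    (hx : Commute w x) (hy : Commute w y) (i j : ℤ) :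
    y ^ j * x ^ i = x ^ i * y ^ j * w ^ (i * j) := by
  have h1 : y * x * y⁻¹ = x * w := by
    rw [h, mul_assoc x y w, ← hy.eq]; group
  have h2 : y * x ^ i * y⁻¹ = x ^ i * w ^ i := by rw [← conj_zpow, h1, hx.symm.mul_zpow]
  have h3 : (x ^ i)⁻¹ * y * ((x ^ i)⁻¹)⁻¹ = y * w ^ i := by
    have := mul_inv_eq_iff_eq_mul.1 h2
    rw [inv_inv, mul_assoc, this, mul_assoc, (hy.zpow_left i).eq]; group
  have h4 : (x ^ i)⁻¹ * y ^ j * ((x ^ i)⁻¹)⁻¹ = y ^ j * w ^ (i * j) := by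
    rw [← conj_zpow, h3, (hy.zpow_left i).symm.mul_zpow, zpow_mul]
  rw [mul_assoc (x ^ i), ← h4]; group

lemma commute_map_of_closure_eq_top {G H : Type*} [Group G] [Group H] {S : Set G}
    (hS : Subgroup.closure S = ⊤) (f : G →* H) (h : ∀ x ∈ S, ∀ y ∈ S, Commute (f x) (f y))
    (x y : G) : Commute (f x) (f y) := by
  have key : ∀ y, (∀ s ∈ S, Commute (f s) (f y)) → ∀ x, Commute (f x) (f y) := by
    intro y hy x
    have hx : x ∈ Subgroup.closure S := hS ▸ Subgroup.mem_top x
    induction hx using Subgroup.closure_induction with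
    | mem s hs => exact hy s hs
    | one => rw [map_one]; exact Commute.one_left _
    | mul a b _ _ ha hb => rw [map_mul]; exact ha.mul_left hb
    | inv a _ ha => rw [map_inv]; exact ha.inv_left
  exact key y (fun s hs => (key s (fun t ht => h t ht s hs) y).symm) x

lemma commutator_le_ker_of_closure_eq_top {G H : Type*} [Group G] [Group H] {S : Set G}
    (hS : Subgroup.closure S = ⊤) (f : G →* H) (h : ∀ x ∈ S, ∀ y ∈ S, Commute (f x) (f y)) :
    commutator G ≤ f.ker := by
  rw [commutator_def, Subgroup.commutator_le]
  intro x _ y _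
  rw [MonoidHom.mem_ker, map_commutatorElement, commutatorElement_eq_one_iff_commute]
  exact commute_map_of_closure_eq_top hS f h x y

lemma commutator_le_of_closure {G : Type*} [Group G] {S : Set G}
    (hS : Subgroup.closure S = ⊤) {N : Subgroup G} [N.Normal]
    (h : ∀ x ∈ S, ∀ y ∈ S, Commute (x : G ⧸ N) (y : G ⧸ N)) : commutator G ≤ N := by
  have := commutator_le_ker_of_closure_eq_top hS (QuotientGroup.mk' N) h
  rwa [QuotientGroup.ker_mk'] at this

lemma zpowers_normal_of_closure_eq_top {G : Type*} [Group G] [Finite G] {S : Set G}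
    (hS : Subgroup.closure S = ⊤) {x : G}
    (h : ∀ s ∈ S, s * x * s⁻¹ ∈ Subgroup.zpowers x) : (Subgroup.zpowers x).Normal := by
  rw [← Subgroup.normalizer_eq_top_iff, eq_top_iff, ← hS, Subgroup.closure_le]
  intro s hs
  apply Subgroup.mem_normalizer_fintype
  intro n hn
  obtain ⟨i, rfl⟩ := Subgroup.mem_zpowers_iff.1 hn
  rw [← conj_zpow]
  exact Subgroup.zpow_mem _ (h s hs) i

lemma commutator_ne_bot_of_not_comm {G : Type*} [Group G]
    (hG : ¬ ∀ x y : G, x * y = y * x) : commutator G ≠ ⊥ := by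
  intro h
  apply hG
  intro x y
  rw [commutator_eq_bot_iff_center_eq_top] at h
  exact (Subgroup.mem_center_iff.1 (h ▸ Subgroup.mem_top y) x)

lemma card_commutator_eq_of_le {G : Type*} [Group G] {p : ℕ} (hp : p.Prime)
    (hG : ¬ ∀ x y : G, x * y = y * x) {N : Subgroup G} (hN : commutator G ≤ N)
    (hc : Nat.card N = p) : Nat.card (commutator G) = p := by
  have h1 := Subgroup.card_dvd_of_le hN
  rw [hc, Nat.dvd_prime hp, Subgroup.card_eq_one] at h1
  exact h1.resolve_left (commutator_ne_bot_of_not_comm hG)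

lemma rank_eq_two_of_closure_pair {G : Type*} [Group G] [Finite G]
    (hG : ¬ ∀ x y : G, x * y = y * x) {x y : G} (h : Subgroup.closure {x, y} = ⊤) :
    Group.rank G = 2 := by
  classical
  apply le_antisymm
  · have h1 : Subgroup.closure (({x, y} : Finset G) : Set G) = ⊤ := by
      rw [Finset.coe_pair]; exact h
    exact (Group.rank_le h1).trans Finset.card_le_two
  · by_contra! hlt
    obtain ⟨S, hS, hcl⟩ := Group.rank_spec G
    have hS1 : S.card ≤ 1 := by omega
    rw [Finset.card_le_one] at hS1
    apply hG
    intro a b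
    refine commute_map_of_closure_eq_top hcl (MonoidHom.id G) (fun s hs t ht => ?_) a b
    rw [hS1 s hs t ht]

lemma QuotientGroup.mk_mul_eq_left_of_mem {G : Type*} [Group G] {N : Subgroup G}
    [N.Normal] {z x : G} (hz : z ∈ N) :
    ((x * z : G) : G ⧸ N) = x := by
  rw [QuotientGroup.mk_mul, (QuotientGroup.eq_one_iff _).2 hz, mul_one]

/-! ### Generators adapted to a maximal subgroup -/

lemma conj_of_commute {Q : Type*} [Group Q] {a β γ x : Q} {n j : ℤ} (h1 : Commute β a)
    (h2 : Commute γ β) (hx : x = a ^ n * β ^ j) (hc : γ * a * γ⁻¹ = a * x) :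
    Commute x a ∧ γ * x * γ⁻¹ = x * x ^ n := by
  have h3 : Commute x a := by
    rw [hx]
    exact ((Commute.refl _).zpow_left _).mul_left (h1.zpow_left _)
  have h5 : γ * β ^ j * γ⁻¹ = β ^ j := by rw [(h2.zpow_right j).eq, mul_inv_cancel_right]
  have h6 : Commute x (β ^ j) := by
    rw [hx]
    exact ((h1.symm.zpow_left n).mul_left ((Commute.refl β).zpow_left j)).zpow_right j
  refine ⟨h3, ?_⟩
  calc γ * x * γ⁻¹ = (γ * a * γ⁻¹) ^ n * (γ * β ^ j * γ⁻¹) := by rw [conj_zpow, hx]; group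
    _ = a ^ n * (x ^ n * β ^ j) := by rw [hc, h5, h3.symm.mul_zpow, mul_assoc]
    _ = x * x ^ n := by rw [(h6.zpow_left n).eq, ← mul_assoc, ← hx]

/-- Generators `c`, `b`, `g` of a group with a maximal subgroup `⟨c, b⟩`, in which the powers of
`c` have index `p`. -/
structure IsFrame {G : Type*} [Group G] (p m : ℕ) (c b g : G) : Prop where
  orderOf_eq : orderOf c = p ^ (m + 2)
  notMem : b ∉ Subgroup.zpowers c
  pow_eq_one : b ^ p = 1
  conj : ∃ a : ℤ, b * c * b⁻¹ = c * (c ^ p ^ (m + 1)) ^ a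
  conj_left : ∃ i j : ℤ, g * c * g⁻¹ = c ^ i * b ^ j
  conj_right : ∃ i j : ℤ, g * b * g⁻¹ = c ^ i * b ^ j
  pow_mem : ∃ i j : ℤ, g ^ p = c ^ i * b ^ j
  closure_eq_top : Subgroup.closure {c, b, g} = ⊤

namespace IsFrame

variable {G : Type*} [Group G] {p m : ℕ} {c b g : G}

lemma orderOf_socle (hp : p.Prime) (h : IsFrame p m c b g) : orderOf (c ^ p ^ (m + 1)) = p := by
  rw [orderOf_pow_of_dvd (pow_ne_zero _ hp.ne_zero) (h.orderOf_eq ▸ pow_dvd_pow p (by omega)),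
    h.orderOf_eq, Nat.pow_div (by omega) hp.pos]
  simp

lemma socle_pow (hp : p.Prime) (h : IsFrame p m c b g) : (c ^ p ^ (m + 1)) ^ p = 1 := by
  conv_lhs => rw [← h.orderOf_socle hp, h.orderOf_socle hp]
  rw [← pow_orderOf_eq_one (c ^ p ^ (m + 1)), h.orderOf_socle hp]

lemma socle_ne_one (hp : p.Prime) (h : IsFrame p m c b g) : c ^ p ^ (m + 1) ≠ 1 := by
  intro h1
  have := h.orderOf_socle hp
  rw [h1, orderOf_one] at this
  exact hp.ne_one this.symm

lemma socle_zpow_pow (hp : p.Prime) (h : IsFrame p m c b g) (a : ℤ) :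
    ((c ^ p ^ (m + 1)) ^ a) ^ p = 1 := by
  rw [← zpow_natCast, zpow_comm, zpow_natCast, h.socle_pow hp, one_zpow]

lemma commute_socle_right (hp : p.Prime) (h : IsFrame p m c b g) :
    Commute (c ^ p ^ (m + 1)) b := by
  obtain ⟨a, ha⟩ := h.conj
  have h1 : Commute ((c ^ p ^ (m + 1)) ^ a) c := ((Commute.refl c).pow_left _).zpow_left _
  have h2 : b * c ^ p ^ (m + 1) * b⁻¹ = c ^ p ^ (m + 1) := by
    rw [← conj_pow, ha, h1.symm.mul_pow, pow_succ' p, pow_mul ((c ^ (p * p ^ m)) ^ a),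
      ← pow_succ' p, h.socle_zpow_pow hp,
      one_pow, mul_one]
  exact (mul_inv_eq_iff_eq_mul.1 h2).symm

/-- The commutator of `b` and `c` is central in `⟨c, b⟩` and killed by `p`, so the `p`-th power is
multiplicative there, and it kills `b`. -/
lemma zpow_mul_zpow_pow (hp : p.Prime) (hp2 : Odd p) (h : IsFrame p m c b g) (i j : ℤ) :
    (c ^ i * b ^ j) ^ p = (c ^ p) ^ i := by
  obtain ⟨a, ha⟩ := h.conj
  have hwc : Commute ((c ^ p ^ (m + 1)) ^ a) c := ((Commute.refl c).pow_left _).zpow_left _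
  have hwb : Commute ((c ^ p ^ (m + 1)) ^ a) b := (h.commute_socle_right hp).zpow_left _
  have h1 : b * c = c * b * (c ^ p ^ (m + 1)) ^ a := by
    rw [mul_inv_eq_iff_eq_mul.1 ha, mul_assoc, hwb.eq, mul_assoc]
  rw [mul_pow_prime_of_commutator hp2 (zpow_mul_zpow_of_commutator h1 hwc hwb i j)
    ((hwc.zpow_left _).zpow_right _) ((hwb.zpow_left _).zpow_right _)]
  · rw [← zpow_natCast, zpow_comm, zpow_natCast, ← zpow_natCast (b ^ j), zpow_comm b,
      zpow_natCast b, h.pow_eq_one, one_zpow, mul_one]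
  · rw [← zpow_mul, h.socle_zpow_pow hp]

lemma socle_eq (p m : ℕ) (c : G) : c ^ p ^ (m + 1) = (c ^ p) ^ p ^ m := by
  rw [← pow_mul, pow_succ']

lemma zpow_right_eq_one (h : IsFrame p m c b g) {j : ℤ} (hj : (p : ℤ) ∣ j) : b ^ j = 1 := by
  obtain ⟨k, rfl⟩ := hj
  rw [zpow_mul, zpow_natCast, h.pow_eq_one, one_zpow]

lemma conj_pow_left (hp : p.Prime) (hp2 : Odd p) (h : IsFrame p m c b g) {i j : ℤ}
    (hc : g * c * g⁻¹ = c ^ i * b ^ j) : g * c ^ p * g⁻¹ = (c ^ p) ^ i := by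
  rw [← conj_pow, hc, h.zpow_mul_zpow_pow hp hp2]

lemma conj_socle (hp : p.Prime) (hp2 : Odd p) (h : IsFrame p m c b g) {i j : ℤ}
    (hc : g * c * g⁻¹ = c ^ i * b ^ j) :
    g * c ^ p ^ (m + 1) * g⁻¹ = (c ^ p ^ (m + 1)) ^ i := by
  rw [socle_eq, ← conj_pow, h.conj_pow_left hp hp2 hc, ← zpow_natCast, zpow_comm, zpow_natCast]

lemma dvd_sub_one (hp : p.Prime) (hp2 : Odd p) (hG : IsPGroup p G) (h : IsFrame p m c b g)
    {i j : ℤ} (hc : g * c * g⁻¹ = c ^ i * b ^ j) : (p : ℤ) ∣ i - 1 :=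
  hG.dvd_sub_one_of_conj hp (h.socle_ne_one hp) (h.socle_pow hp) (h.conj_socle hp hp2 hc)

/-- Conjugation by `g` raises this element of order `p` to the power `i`, and `i ≡ 1` modulo `p`
because `G` is a `p`-group. -/
lemma socle_mem_center (hp : p.Prime) (hp2 : Odd p) (hG : IsPGroup p G)
    (h : IsFrame p m c b g) : c ^ p ^ (m + 1) ∈ Subgroup.center G := by
  have hg : Commute g (c ^ p ^ (m + 1)) := by
    obtain ⟨i, j, hc⟩ := h.conj_left
    obtain ⟨k, hk⟩ := h.dvd_sub_one hp hp2 hG hc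
    have := h.conj_socle hp hp2 hc
    rw [eq_add_of_sub_eq hk, zpow_add, zpow_mul, zpow_natCast, h.socle_pow hp, one_zpow,
      one_mul, zpow_one] at this
    exact mul_inv_eq_iff_eq_mul.1 this
  have hle : Subgroup.closure {c, b, g} ≤ Subgroup.centralizer {c ^ p ^ (m + 1)} := by
    rw [Subgroup.closure_le]
    rintro x (rfl | rfl | rfl)
    · exact Subgroup.mem_centralizer_singleton_iff.2 ((Commute.refl _).pow_right _)
    · exact Subgroup.mem_centralizer_singleton_iff.2 (h.commute_socle_right hp).symm
    · exact Subgroup.mem_centralizer_singleton_iff.2 hg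
  rw [h.closure_eq_top] at hle
  rw [Subgroup.mem_center_iff]
  intro x
  exact Subgroup.mem_centralizer_singleton_iff.1 (hle (Subgroup.mem_top x))

lemma zpowers_normal (hp : p.Prime) (hp2 : Odd p) (hG : IsPGroup p G)
    (h : IsFrame p m c b g) : (Subgroup.zpowers (c ^ p ^ (m + 1))).Normal := by
  refine ⟨fun x hx y => ?_⟩
  have h1 := (Subgroup.zpowers_le.2 (h.socle_mem_center hp hp2 hG)) hx
  rw [Subgroup.mem_center_iff.1 h1 y, mul_inv_cancel_right]
  exact hx

/-- The image of `b` in the quotient by the central subgroup of order `p` of `⟨c⟩` is central. -/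
lemma conj_right_eq (hp : p.Prime) (hp2 : Odd p) (hG : IsPGroup p G)
    (h : IsFrame p m c b g) : ∃ z ∈ Subgroup.zpowers (c ^ p ^ (m + 1)), g * b * g⁻¹ = z * b := by
  have hn := h.zpowers_normal hp hp2 hG
  obtain ⟨i, j, hij⟩ := h.conj_right
  -- The conjugate of `b` has trivial `p`-th power, which forces `p ^ (m + 1) ∣ i`.
  have h1 : c ^ ((p : ℤ) * i) = 1 := by
    rw [zpow_mul, zpow_natCast, ← h.zpow_mul_zpow_pow hp hp2 i j, ← hij, conj_pow, h.pow_eq_one]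
    group
  rw [← orderOf_dvd_iff_zpow_eq_one, h.orderOf_eq, pow_succ'] at h1
  push_cast at h1
  obtain ⟨k, rfl⟩ := (mul_dvd_mul_iff_left (by exact_mod_cast hp.ne_zero)).1 h1
  have hz : c ^ ((p : ℤ) ^ (m + 1) * k) = (c ^ p ^ (m + 1)) ^ k := by
    rw [zpow_mul]; norm_cast
  rw [hz] at hij
  have hj : (p : ℤ) ∣ j - 1 := by
    refine (hG.to_quotient (Subgroup.zpowers (c ^ p ^ (m + 1)))).dvd_sub_one_of_conj hp
      (x := (b : G ⧸ _)) (g := (g : G ⧸ _)) ?_ ?_ ?_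
    · rw [Ne, QuotientGroup.eq_one_iff]
      intro hb
      exact h.notMem
        ((Subgroup.zpowers_le.2 (Subgroup.pow_mem _ (Subgroup.mem_zpowers c) _)) hb)
    · rw [← QuotientGroup.mk_pow, h.pow_eq_one, QuotientGroup.mk_one]
    · rw [← QuotientGroup.mk_mul, ← QuotientGroup.mk_inv, ← QuotientGroup.mk_mul, hij,
        QuotientGroup.mk_mul, (QuotientGroup.eq_one_iff _).2, one_mul, QuotientGroup.mk_zpow]
      exact Subgroup.zpow_mem _ (Subgroup.mem_zpowers _) _
  refine ⟨_, Subgroup.zpow_mem _ (Subgroup.mem_zpowers _) k, ?_⟩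
  rw [hij, ← sub_add_cancel j 1, zpow_add, h.zpow_right_eq_one hj, one_mul, zpow_one]

lemma commutator_le_of_normal_zpowers [Finite G] (hp : p.Prime) (hp2 : Odd p)
    (hG : IsPGroup p G) (h : IsFrame p m c b g) {i j : ℤ} (hc : g * c * g⁻¹ = c ^ i * b ^ j)
    (hj : (p : ℤ) ∣ j) (hi : (Subgroup.zpowers c).index = p ^ 2) :
    IsMetacyclic G ∨ commutator G ≤ Subgroup.zpowers (c ^ p ^ (m + 1)) := by
  rw [h.zpow_right_eq_one hj, mul_one] at hc
  obtain ⟨a, ha⟩ := h.conj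
  have hz (a : ℤ) : (c ^ p ^ (m + 1)) ^ a ∈ Subgroup.zpowers (c ^ p ^ (m + 1)) :=
    Subgroup.zpow_mem _ (Subgroup.mem_zpowers _) _
  have hle : Subgroup.zpowers (c ^ p ^ (m + 1)) ≤ Subgroup.zpowers c :=
    Subgroup.zpowers_le.2 (Subgroup.pow_mem _ (Subgroup.mem_zpowers c) _)
  have hC : (Subgroup.zpowers c).Normal := by
    apply zpowers_normal_of_closure_eq_top h.closure_eq_top
    rintro s (rfl | rfl | rfl)
    · rw [mul_inv_cancel_right]; exact Subgroup.mem_zpowers _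
    · rw [ha]; exact Subgroup.mul_mem _ (Subgroup.mem_zpowers _) (hle (hz a))
    · rw [hc]; exact Subgroup.zpow_mem _ (Subgroup.mem_zpowers _) _
  by_cases hcyc : IsCyclic (G ⧸ Subgroup.zpowers c)
  · exact Or.inl ⟨_, hC, inferInstance, hcyc⟩
  right
  -- A noncyclic group of order `p ^ 2` has exponent `p`.
  have hgp : g ^ p ∈ Subgroup.zpowers c := by
    rw [← QuotientGroup.eq_one_iff, QuotientGroup.mk_pow, ← orderOf_dvd_iff_pow_eq_one]
    have hcard : Nat.card (G ⧸ Subgroup.zpowers c) = p ^ 2 := hi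
    obtain ⟨k, hk, hk2⟩ := (Nat.dvd_prime_pow hp).1
      (hcard ▸ orderOf_dvd_natCard (g : G ⧸ Subgroup.zpowers c))
    have : k ≠ 2 := by
      rintro rfl
      exact hcyc (isCyclic_of_orderOf_eq_card (g : G ⧸ Subgroup.zpowers c) (by rw [hk2, hcard]))
    rw [hk2]
    exact (pow_dvd_pow p (by omega : k ≤ 1)).trans (by rw [pow_one])
  have hcg : Commute (g ^ p) c := by
    obtain ⟨s, hs⟩ := Subgroup.mem_zpowers_iff.1 hgp
    rw [← hs]; exact (Commute.refl c).zpow_left s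
  obtain ⟨a', ha'⟩ := conj_eq_mul_zpow_of_commute_pow hp hp2 h.orderOf_eq hc hcg
  obtain ⟨z, hzm, hb⟩ := h.conj_right_eq hp hp2 hG
  have hn := h.zpowers_normal hp hp2 hG
  have hgb : Commute (g : G ⧸ Subgroup.zpowers (c ^ p ^ (m + 1))) b := by
    rw [Commute, SemiconjBy, ← QuotientGroup.mk_mul, mul_inv_eq_iff_eq_mul.1 hb, mul_assoc,
      QuotientGroup.mk_mul, (QuotientGroup.eq_one_iff _).2 hzm, one_mul, QuotientGroup.mk_mul]
  have hgc : Commute (g : G ⧸ Subgroup.zpowers (c ^ p ^ (m + 1))) c := by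
    rw [Commute, SemiconjBy, ← QuotientGroup.mk_mul, mul_inv_eq_iff_eq_mul.1 ha',
      QuotientGroup.mk_mul, QuotientGroup.mk_mul, (QuotientGroup.eq_one_iff _).2 (hz a'), mul_one]
  have hbc : Commute (b : G ⧸ Subgroup.zpowers (c ^ p ^ (m + 1))) c := by
    rw [Commute, SemiconjBy, ← QuotientGroup.mk_mul, mul_inv_eq_iff_eq_mul.1 ha,
      QuotientGroup.mk_mul, QuotientGroup.mk_mul, (QuotientGroup.eq_one_iff _).2 (hz a), mul_one]
  apply commutator_le_of_closure h.closure_eq_top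
  rintro x (rfl | rfl | rfl) y (rfl | rfl | rfl)
  exacts [Commute.refl _, hbc.symm, hgc.symm, hbc, Commute.refl _, hgb.symm, hgc, hgb,
    Commute.refl _]

lemma conj_eq_mul {i j k : ℤ} (hc : g * c * g⁻¹ = c ^ i * b ^ j) (hk : i - 1 = p * k) :
    g * c * g⁻¹ = c * (c ^ ((p : ℤ) * k) * b ^ j) := by
  rw [hc, eq_add_of_sub_eq hk, ← mul_assoc, zpow_add, zpow_one, ((Commute.refl c).zpow_left _).eq]

lemma pow_eq (hp : p.Prime) (hp2 : Odd p) (h : IsFrame p m c b g) (j k : ℤ) :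
    (c ^ ((p : ℤ) * k) * b ^ j) ^ p = (c ^ p) ^ ((p : ℤ) * k) :=
  h.zpow_mul_zpow_pow hp hp2 _ _

lemma quotient_commute_left (hp : p.Prime) (hp2 : Odd p) (hG : IsPGroup p G)
    (h : IsFrame p m c b g) [(Subgroup.zpowers (c ^ p ^ (m + 1))).Normal] :
    Commute (b : G ⧸ Subgroup.zpowers (c ^ p ^ (m + 1))) c := by
  obtain ⟨a, ha⟩ := h.conj
  have h1 := (Subgroup.mem_center_iff.1
    (Subgroup.zpow_mem _ (h.socle_mem_center hp hp2 hG) a) b)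
  rw [Commute, SemiconjBy, ← QuotientGroup.mk_mul, mul_inv_eq_iff_eq_mul.1 ha, mul_assoc, ← h1,
    ← mul_assoc, QuotientGroup.mk_mul_eq_left_of_mem
      (Subgroup.zpow_mem _ (Subgroup.mem_zpowers _) _),
    QuotientGroup.mk_mul]

lemma quotient_commute_right (hp : p.Prime) (hp2 : Odd p) (hG : IsPGroup p G)
    (h : IsFrame p m c b g) [(Subgroup.zpowers (c ^ p ^ (m + 1))).Normal] :
    Commute (g : G ⧸ Subgroup.zpowers (c ^ p ^ (m + 1))) b := by
  obtain ⟨z, hzm, hb⟩ := h.conj_right_eq hp hp2 hG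
  rw [Commute, SemiconjBy, ← QuotientGroup.mk_mul, mul_inv_eq_iff_eq_mul.1 hb, mul_assoc,
    QuotientGroup.mk_mul, (QuotientGroup.eq_one_iff _).2 hzm, one_mul, QuotientGroup.mk_mul]

lemma quotient_conj (hp : p.Prime) (hp2 : Odd p) (hG : IsPGroup p G)
    (h : IsFrame p m c b g) [(Subgroup.zpowers (c ^ p ^ (m + 1))).Normal] {i j k : ℤ}
    (hc : g * c * g⁻¹ = c ^ i * b ^ j) (hk : i - 1 = p * k)
    {x γ a : G ⧸ Subgroup.zpowers (c ^ p ^ (m + 1))} (hγ : γ = g) (ha : a = c)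
    (hx : x = ((c ^ ((p : ℤ) * k) * b ^ j : G) : G ⧸ Subgroup.zpowers (c ^ p ^ (m + 1)))) :
    Commute x a ∧ γ * a * γ⁻¹ = a * x ∧ γ * x * γ⁻¹ = x * (x ^ p) ^ k := by
  have h4 : γ * a * γ⁻¹ = a * x := by
    rw [hx, hγ, ha, ← QuotientGroup.mk_mul, ← QuotientGroup.mk_inv, ← QuotientGroup.mk_mul,
      ← QuotientGroup.mk_mul, conj_eq_mul hc hk]
  subst hγ ha
  have h5 := conj_of_commute (h.quotient_commute_left hp hp2 hG)
    (h.quotient_commute_right hp hp2 hG) (by rw [hx]; rfl) h4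
  refine ⟨h5.1, h4, h5.2.trans ?_⟩
  rw [zpow_mul, zpow_natCast]

lemma closure_pair_eq_top (hp : p.Prime) (h : IsFrame p m c b g) {i j : ℤ}
    (hc : g * c * g⁻¹ = c ^ i * b ^ j) (hj : ¬ (p : ℤ) ∣ j) :
    Subgroup.closure {c, g} = ⊤ := by
  have hcm : c ∈ Subgroup.closure {c, g} := Subgroup.subset_closure (by simp)
  have hgm : g ∈ Subgroup.closure {c, g} := Subgroup.subset_closure (by simp)
  rw [eq_top_iff, ← h.closure_eq_top, Subgroup.closure_le]
  rintro x (rfl | rfl | rfl)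
  · exact hcm
  · apply zpow_mem_of_isCoprime (Int.isCoprime_prime_of_not_dvd hp hj)
    · rw [← inv_mul_eq_iff_eq_mul.2 hc]
      exact Subgroup.mul_mem _ (Subgroup.inv_mem _ (Subgroup.zpow_mem _ hcm _))
        (Subgroup.mul_mem _ (Subgroup.mul_mem _ hgm hcm) (Subgroup.inv_mem _ hgm))
    · rw [zpow_natCast, h.pow_eq_one]; exact Subgroup.one_mem _
  · exact hgm

/-- Modulo the socle of `⟨c⟩`, the element `η = c ^ (p * k) * b ^ j` commutes with `c`, and `g`
conjugates it to one of its powers. So it generates a normal subgroup, modulo which the generators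
`c` and `g` commute. -/
lemma exists_of_mem_commutator [Finite G] (hp : p.Prime) (hp2 : Odd p) (hG : IsPGroup p G)
    (h : IsFrame p m c b g) {i j k : ℤ} (hc : g * c * g⁻¹ = c ^ i * b ^ j)
    (hk : i - 1 = p * k) (hj : ¬ (p : ℤ) ∣ j) {x : G} (hx : x ∈ commutator G) :
    ∃ y ∈ Subgroup.zpowers (c ^ ((p : ℤ) * k) * b ^ j),
      ∃ z ∈ Subgroup.zpowers (c ^ p ^ (m + 1)), x = y * z := by
  have hn := h.zpowers_normal hp hp2 hG
  obtain ⟨h1, h2, h3⟩ := h.quotient_conj hp hp2 hG hc hk rfl rfl rfl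
  set η := ((c ^ ((p : ℤ) * k) * b ^ j : G) : G ⧸ Subgroup.zpowers (c ^ p ^ (m + 1))) with hη
  have hcl := h.closure_pair_eq_top hp hc hj
  have hn2 : (Subgroup.zpowers η).Normal := by
    have hcl2 : Subgroup.closure
        (QuotientGroup.mk' (Subgroup.zpowers (c ^ p ^ (m + 1))) '' {c, g}) = ⊤ := by
      rw [← MonoidHom.map_closure, hcl, Subgroup.map_top_of_surjective]
      exact QuotientGroup.mk'_surjective _
    apply zpowers_normal_of_closure_eq_top hcl2
    rintro _ ⟨s, (rfl | rfl), rfl⟩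
    · rw [QuotientGroup.mk'_apply, ← h1.eq, mul_inv_cancel_right]; exact Subgroup.mem_zpowers _
    · rw [QuotientGroup.mk'_apply, h3]
      exact Subgroup.mul_mem _ (Subgroup.mem_zpowers _) (Subgroup.zpow_mem _
        (Subgroup.pow_mem _ (Subgroup.mem_zpowers _) _) _)
  have hgc : Commute (((g : G ⧸ Subgroup.zpowers (c ^ p ^ (m + 1))) : _ ⧸ Subgroup.zpowers η))
      ((c : G ⧸ Subgroup.zpowers (c ^ p ^ (m + 1))) : _ ⧸ Subgroup.zpowers η) := by
    rw [Commute, SemiconjBy, ← QuotientGroup.mk_mul, mul_inv_eq_iff_eq_mul.1 h2, h1.symm.eq,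
      mul_assoc, QuotientGroup.mk_mul,
      (QuotientGroup.eq_one_iff _).2 (Subgroup.mem_zpowers η), one_mul, QuotientGroup.mk_mul]
  have hker := commutator_le_ker_of_closure_eq_top hcl
    ((QuotientGroup.mk' (Subgroup.zpowers η)).comp (QuotientGroup.mk' _)) (by
      rintro x (rfl | rfl) y (rfl | rfl)
      exacts [Commute.refl _, hgc.symm, hgc, Commute.refl _]) hx
  rw [MonoidHom.mem_ker, MonoidHom.comp_apply, QuotientGroup.mk'_apply,
    QuotientGroup.eq_one_iff] at hker
  obtain ⟨n, hn⟩ := Subgroup.mem_zpowers_iff.1 hker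
  refine ⟨_, Subgroup.zpow_mem _ (Subgroup.mem_zpowers _) n, _, ?_,
    (mul_inv_cancel_left _ x).symm⟩
  rw [← QuotientGroup.eq_one_iff, QuotientGroup.mk_mul, QuotientGroup.mk_inv,
    QuotientGroup.mk_zpow, ← hη, hn, QuotientGroup.mk'_apply, inv_mul_cancel]

/-- The commutator subgroup when the commutator of `g` and `c` has order dividing `p`. -/
lemma commutator_of_pow_eq_one [Finite G] (hp : p.Prime) (hp2 : Odd p) (hG : IsPGroup p G)
    (hnonab : ¬ ∀ x y : G, x * y = y * x)
    (h : IsFrame p m c b g) {i j k : ℤ} (hc : g * c * g⁻¹ = c ^ i * b ^ j)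
    (hk : i - 1 = p * k) (hj : ¬ (p : ℤ) ∣ j) (hh : (c ^ ((p : ℤ) * k) * b ^ j) ^ p = 1) :
    Nat.card (commutator G) = p ∨
      (IsElementaryAbelian p (commutator G) ∧ Nat.card (commutator G) = p ^ 2 ∧
        Group.rank G = 2) := by
  have hex := fun x : commutator G => h.exists_of_mem_commutator hp hp2 hG hc hk hj x.2
  set η := c ^ ((p : ℤ) * k) * b ^ j with hη
  have hcen : Subgroup.zpowers (c ^ p ^ (m + 1)) ≤ Subgroup.center G :=
    Subgroup.zpowers_le.2 (h.socle_mem_center hp hp2 hG)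
  choose Y hY Z hZ hYZ using hex
  have hle : Nat.card (commutator G) ≤ p ^ 2 := by
    let f : commutator G → Subgroup.zpowers η × Subgroup.zpowers (c ^ p ^ (m + 1)) :=
      fun x => (⟨Y x, hY x⟩, ⟨Z x, hZ x⟩)
    have hf : Function.Injective f := by
      intro x y hxy
      simp only [f, Prod.mk.injEq, Subtype.mk.injEq] at hxy
      exact Subtype.ext (by rw [hYZ x, hYZ y, hxy.1, hxy.2])
    refine (Nat.card_le_card_of_injective f hf).trans ?_
    rw [Nat.card_prod, Nat.card_zpowers, Nat.card_zpowers, h.orderOf_socle hp, sq]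
    exact Nat.mul_le_mul_right _ (orderOf_le_of_pow_eq_one hp.pos hh)
  have := Fact.mk hp
  obtain ⟨n, hn⟩ := IsPGroup.iff_card.1 (hG.to_subgroup (commutator G))
  have hn2 : n ≤ 2 := by
    rw [hn] at hle
    exact (Nat.pow_le_pow_iff_right hp.one_lt).1 hle
  have hn0 : n ≠ 0 := by
    rintro rfl
    rw [pow_zero, Subgroup.card_eq_one] at hn
    exact commutator_ne_bot_of_not_comm hnonab hn
  obtain rfl | rfl : n = 1 ∨ n = 2 := by omega
  · left; rw [hn, pow_one]
  · refine Or.inr ⟨⟨fun x y => Subtype.ext ?_, fun x => Subtype.ext ?_⟩, hn,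
      rank_eq_two_of_closure_pair hnonab (h.closure_pair_eq_top hp hc hj)⟩
    · have h1 : Commute (Y x) (Y y) := by
        obtain ⟨s, hs⟩ := Subgroup.mem_zpowers_iff.1 (hY x)
        obtain ⟨t, ht⟩ := Subgroup.mem_zpowers_iff.1 (hY y)
        rw [← hs, ← ht]
        exact ((Commute.refl η).zpow_left s).zpow_right t
      have hZc (x) (u : G) : Commute u (Z x) := Subgroup.mem_center_iff.1 (hcen (hZ x)) u
      change (x : G) * y = y * x
      rw [hYZ x, hYZ y]
      exact (h1.mul_right (hZc y _)).mul_left ((hZc x _).symm)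
    · change (x : G) ^ p = 1
      obtain ⟨s, hs⟩ := Subgroup.mem_zpowers_iff.1 (hY x)
      obtain ⟨t, ht⟩ := Subgroup.mem_zpowers_iff.1 (hZ x)
      have hYZc : Commute (Y x) (Z x) := Subgroup.mem_center_iff.1 (hcen (hZ x)) (Y x)
      rw [hYZ x, hYZc.mul_pow, ← ht, h.socle_zpow_pow hp, ← hs, ← zpow_natCast, zpow_comm,
        zpow_natCast, hh, one_zpow, mul_one]

end IsFrame

/-! ### The metacyclic case -/

lemma isMetacyclic_of_commutator_le {G : Type*} [Group G] {c g y : G}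
    (hcl : Subgroup.closure {c, g} = ⊤) (hy : commutator G ≤ Subgroup.zpowers y)
    {u : ℤ} (hyu : y = g * c ^ u) : IsMetacyclic G := by
  have hn : (Subgroup.zpowers y).Normal := Subgroup.Normal.of_commutator_le G hy
  refine ⟨_, hn, inferInstance, ⟨(c : G ⧸ Subgroup.zpowers y), fun x => ?_⟩⟩
  obtain ⟨x, rfl⟩ := QuotientGroup.mk_surjective x
  have hle : Subgroup.closure {c, g} ≤ (Subgroup.zpowers (c : G ⧸ Subgroup.zpowers y)).comap
      (QuotientGroup.mk' (Subgroup.zpowers y)) := by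
    rw [Subgroup.closure_le]
    rintro s (rfl | rfl)
    · exact Subgroup.mem_zpowers _
    · refine Subgroup.mem_zpowers_iff.2 ⟨-u, ?_⟩
      have h1 : s = y * c ^ (-u) := by rw [hyu]; group
      rw [h1, QuotientGroup.mk'_apply, QuotientGroup.mk_mul,
        (QuotientGroup.eq_one_iff y).2 (Subgroup.mem_zpowers y), one_mul, QuotientGroup.mk_zpow]
  rw [hcl] at hle
  exact hle (Subgroup.mem_top x)

namespace IsFrame

variable {G : Type*} [Group G] {p m : ℕ} {c b g : G}

lemma commute_pow_left (hp : p.Prime) (h : IsFrame p m c b g) (i j : ℤ) :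
    Commute (c ^ i * b ^ j) (c ^ p) := by
  have h1 : Commute b (c ^ p) := by
    obtain ⟨a, ha⟩ := h.conj
    have h1 : Commute ((c ^ p ^ (m + 1)) ^ a) c := ((Commute.refl c).pow_left _).zpow_left _
    have h2 : b * c ^ p * b⁻¹ = c ^ p := by
      rw [← conj_pow, ha, h1.symm.mul_pow, h.socle_zpow_pow hp, mul_one]
    exact mul_inv_eq_iff_eq_mul.1 h2
  exact (((Commute.refl c).zpow_left i).pow_right p).mul_left (h1.zpow_left j)

/-- Since `g ^ p` lies in `⟨c, b⟩`, it centralizes `c ^ p`. So `g` acts on `⟨c ^ p⟩` with order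
dividing `p`, and it moves `c ^ p` only by a socle element, which is the `p`-th power in question.
-/
lemma pow_mem_socle (hp : p.Prime) (hp2 : Odd p) (h : IsFrame p m c b g) {i j k : ℤ}
    (hc : g * c * g⁻¹ = c ^ i * b ^ j) (hk : i - 1 = p * k) :
    ∃ a : ℤ, (c ^ ((p : ℤ) * k) * b ^ j) ^ p = (c ^ p ^ (m + 1)) ^ a := by
  obtain ⟨s, t, hst⟩ := h.pow_mem
  have ho : orderOf (c ^ p) = p ^ (m + 1) := by
    rw [orderOf_pow_of_dvd hp.ne_zero (h.orderOf_eq ▸ dvd_pow_self p (by omega)), h.orderOf_eq,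
      pow_succ, Nat.mul_div_cancel _ hp.pos]
  have h1 := h.conj_pow_left hp hp2 hc
  obtain ⟨a, ha⟩ := conj_eq_mul_zpow_of_commute_pow hp hp2 ho h1
    (hst ▸ h.commute_pow_left hp s t)
  refine ⟨a, ?_⟩
  rw [h1, eq_add_of_sub_eq hk, add_comm, zpow_add, zpow_one, ← socle_eq] at ha
  rw [h.pow_eq hp hp2]
  exact mul_left_cancel ha

lemma isMetacyclic_of_pow_ne_one [Finite G] (hp : p.Prime) (hp2 : Odd p) (hG : IsPGroup p G)
    (h : IsFrame p m c b g) {i j k : ℤ} (hc : g * c * g⁻¹ = c ^ i * b ^ j)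
    (hk : i - 1 = p * k) (hj : ¬ (p : ℤ) ∣ j) (hh : (c ^ ((p : ℤ) * k) * b ^ j) ^ p ≠ 1) :
    IsMetacyclic G := by
  have hcen : Subgroup.zpowers (c ^ p ^ (m + 1)) ≤ Subgroup.center G :=
    Subgroup.zpowers_le.2 (h.socle_mem_center hp hp2 hG)
  have hn := h.zpowers_normal hp hp2 hG
  obtain ⟨e, he⟩ := h.pow_mem_socle hp hp2 hc hk
  obtain ⟨s, t, hst⟩ := h.pow_mem
  have hgc := conj_eq_mul hc hk
  have hqγβ := h.quotient_commute_right hp hp2 hG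
  have hcl := h.closure_pair_eq_top hp hc hj
  have hcomm := fun x => h.exists_of_mem_commutator hp hp2 hG hc hk hj (x := x)
  obtain ⟨q, hq⟩ : ∃ q : G →* G ⧸ Subgroup.zpowers (c ^ p ^ (m + 1)),
    q = QuotientGroup.mk' _ := ⟨_, rfl⟩
  have hq1 (x : G) : q x = 1 ↔ x ∈ Subgroup.zpowers (c ^ p ^ (m + 1)) := by
    rw [hq]; exact QuotientGroup.eq_one_iff x
  obtain ⟨hηa, hγa, hγη⟩ := h.quotient_conj hp hp2 hG hc hk (γ := q g) (a := q c)
    (x := q (c ^ ((p : ℤ) * k) * b ^ j)) (by rw [hq]; rfl) (by rw [hq]; rfl) (by rw [hq]; rfl)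
  have hqγβ : Commute (q g) (q b) := by rw [hq]; exact hqγβ
  have hqη : q (c ^ ((p : ℤ) * k) * b ^ j) = q c ^ ((p : ℤ) * k) * q b ^ j := by
    rw [map_mul, map_zpow, map_zpow]
  set η := c ^ ((p : ℤ) * k) * b ^ j with hη
  have hηp : q η ^ p = 1 := by
    rw [← map_pow, hq1, he]; exact Subgroup.zpow_mem _ (Subgroup.mem_zpowers _) _
  rw [hηp, one_zpow, mul_one] at hγη
  have hγη' : Commute (q g) (q η) := mul_inv_eq_iff_eq_mul.1 hγη
  have hη1 : q η ≠ 1 := by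
    intro h1
    obtain ⟨l, hl⟩ := Subgroup.mem_zpowers_iff.1 ((hq1 _).1 h1)
    exact hh (by rw [← hl, h.socle_zpow_pow hp])
  -- This holds in `G` itself: the commutator of `g` and `η` is central of order dividing `p`, so
  -- its `p.choose 2`-th power vanishes.
  have hgp : g ^ p * c * (g ^ p)⁻¹ = c * η ^ p := by
    have hζ : η⁻¹ * (g * η * g⁻¹) ∈ Subgroup.zpowers (c ^ p ^ (m + 1)) := by
      rw [← hq1, map_mul, map_mul, map_mul, map_inv, map_inv, hγη, inv_mul_cancel]
    have hζc (u : G) : Commute u _ := Subgroup.mem_center_iff.1 (hcen hζ) u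
    have hζp : (η⁻¹ * (g * η * g⁻¹)) ^ p = 1 := by
      obtain ⟨l, hl⟩ := Subgroup.mem_zpowers_iff.1 hζ
      rw [← hl, h.socle_zpow_pow hp]
    rw [conj_pow_of_conj hgc (mul_inv_cancel_left η _).symm (hζc g).symm (hζc η).symm,
      pow_choose_two_eq_one hp2 hζp, mul_one]
  -- Otherwise `g ^ p ∈ ⟨c⟩` commutes with `c`, and `η ^ p = 1`.
  have ht : ¬ (p : ℤ) ∣ t := by
    intro ht
    rw [h.zpow_right_eq_one ht, mul_one] at hst
    rw [hst, ((Commute.refl c).zpow_left s).eq, mul_inv_cancel_right] at hgp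
    exact hh (mul_left_cancel (hgp.symm.trans (mul_one c).symm))
  have hqst : q g ^ p = q c ^ s * q b ^ t := by
    rw [← map_pow, hst, map_mul, map_zpow, map_zpow]
  -- Modulo the socle, conjugation by `g` multiplies `g ^ p = c ^ s * b ^ t` by `η ^ s`, yet `g`
  -- fixes `g ^ p`; and the image of `η` has order `p`.
  have hs : (p : ℤ) ∣ s := by
    by_contra hs
    have h1 : q g * (q c ^ s * q b ^ t) * (q g)⁻¹ = q c ^ s * q η ^ s * q b ^ t := by
      have h2 : q g * q b ^ t * (q g)⁻¹ = q b ^ t := by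
        rw [(hqγβ.zpow_right t).eq, mul_inv_cancel_right]
      calc q g * (q c ^ s * q b ^ t) * (q g)⁻¹
          = (q g * q c * (q g)⁻¹) ^ s * (q g * q b ^ t * (q g)⁻¹) := by rw [conj_zpow]; group
        _ = _ := by rw [h2, hγa, hηa.symm.mul_zpow]
    rw [← hqst, ((Commute.refl (q g)).pow_right p).eq, mul_inv_cancel_right, hqst] at h1
    have h3 : q η ^ s = 1 := by
      have := mul_right_cancel h1
      exact mul_left_cancel (this.symm.trans (mul_one _).symm)
    refine hη1 ((Subgroup.mem_bot).1 (zpow_mem_of_isCoprime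
      (Int.isCoprime_prime_of_not_dvd hp hs) (Subgroup.mem_bot.2 h3) (Subgroup.mem_bot.2 ?_)))
    rw [zpow_natCast, hηp]
  obtain ⟨s', rfl⟩ := hs
  obtain ⟨A, B, hAB⟩ := Int.isCoprime_prime_of_not_dvd hp hj
  -- `A` inverts `j` modulo `p`, so `η ^ v` has the same `b`-part as `g ^ p`.
  obtain ⟨v, hv⟩ : ∃ v, v = t * A := ⟨_, rfl⟩
  have hvj : j * v = t + p * (-(t * B)) := by
    rw [hv]; linear_combination t * hAB
  have hvp : ¬ (p : ℤ) ∣ v := by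
    intro hd
    apply ht
    have : t = j * v + p * (t * B) := by rw [hvj]; ring
    rw [this]
    exact dvd_add (hd.mul_left j) (dvd_mul_right _ _)
  -- This `u` solves `p * s' + p * u = p * k * v`, matching the `c`-parts of `(g * c ^ u) ^ p` and
  -- `η ^ v` modulo the socle.
  obtain ⟨u, hu⟩ : ∃ u, u = k * v - s' := ⟨_, rfl⟩
  obtain ⟨y, hy⟩ : ∃ y, y = g * c ^ u := ⟨_, rfl⟩
  have hqb (j : ℤ) (hj : (p : ℤ) ∣ j) : q b ^ j = 1 := by
    rw [← map_zpow, h.zpow_right_eq_one hj, map_one]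
  have hβa : Commute (q b) (q c) := by
    rw [hq]; exact h.quotient_commute_left hp hp2 hG
  have hqy : q y ^ p = q η ^ v := by
    have h1 : q c ^ u * q g = q g * q c ^ u * q η ^ (-u) := by
      have h2 : q g * q c ^ u * (q g)⁻¹ = q c ^ u * q η ^ u := by
        rw [← conj_zpow, hγa, hηa.symm.mul_zpow]
      rw [mul_inv_eq_iff_eq_mul.1 h2, mul_assoc, mul_assoc, (hγη'.zpow_right (-u)).eq]
      group
    rw [hy, map_mul, map_zpow, mul_pow_prime_of_commutator hp2 h1 (hγη'.symm.zpow_left _)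
      ((hηa.zpow_left _).zpow_right _), hqst, hqη,
      ((hβa.symm.zpow_left _).zpow_right j).mul_zpow, ← zpow_mul, ← zpow_mul, hvj, zpow_add (q b),
      hqb _ (dvd_mul_right _ _), mul_one, mul_assoc, ← zpow_natCast (q c ^ u), ← zpow_mul,
      ((hβa.zpow_left t).zpow_right _).eq, ← mul_assoc, ← zpow_add, hu]
    · congr 2; ring
    · rw [← zpow_natCast (q η ^ (-u)), zpow_comm (q η), zpow_natCast (q η), hηp, one_zpow]
  have hyp : (η ^ v)⁻¹ * y ^ p ∈ Subgroup.zpowers (c ^ p ^ (m + 1)) := by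
    rw [← hq1, map_mul, map_inv, map_zpow, map_pow, hqy, inv_mul_cancel]
  obtain ⟨l, hl⟩ := Subgroup.mem_zpowers_iff.1 hyp
  have hηpp : (η ^ p) ^ p = 1 := by rw [he, h.socle_zpow_pow hp]
  have hypp : y ^ (p * p) = (η ^ p) ^ v := by
    have h1 : y ^ p = η ^ v * (c ^ p ^ (m + 1)) ^ l := by rw [hl, mul_inv_cancel_left]
    have h2 : Commute (η ^ v) ((c ^ p ^ (m + 1)) ^ l) :=
      Subgroup.mem_center_iff.1 (hcen (hl ▸ hyp)) _
    rw [pow_mul, h1, h2.mul_pow, h.socle_zpow_pow hp, mul_one, ← zpow_natCast, zpow_comm,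
      zpow_natCast]
  -- Membership climbs from `y ^ (p * p)` to `η ^ p`, then to the socle it generates, then to `η`,
  -- since `p ∤ v`.
  have hηpy : η ^ p ∈ Subgroup.zpowers y := by
    apply zpow_mem_of_isCoprime (Int.isCoprime_prime_of_not_dvd hp hvp)
    · rw [← hypp]; exact Subgroup.pow_mem _ (Subgroup.mem_zpowers y) _
    · rw [zpow_natCast, hηpp]; exact Subgroup.one_mem _
  have hzy : c ^ p ^ (m + 1) ∈ Subgroup.zpowers y := by
    have hpe : ¬ (p : ℤ) ∣ e := by
      rintro ⟨e', rfl⟩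
      apply hh
      rw [he, zpow_mul, zpow_natCast, h.socle_pow hp, one_zpow]
    apply zpow_mem_of_isCoprime (Int.isCoprime_prime_of_not_dvd hp hpe)
    · rw [← he]; exact hηpy
    · rw [zpow_natCast, h.socle_pow hp]; exact Subgroup.one_mem _
  have hηy : η ∈ Subgroup.zpowers y := by
    apply zpow_mem_of_isCoprime (Int.isCoprime_prime_of_not_dvd hp hvp)
    · have h1 : η ^ v = y ^ p * ((c ^ p ^ (m + 1)) ^ l)⁻¹ := by rw [hl]; group
      rw [h1]
      exact Subgroup.mul_mem _ (Subgroup.pow_mem _ (Subgroup.mem_zpowers y) _)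
        (Subgroup.inv_mem _ (Subgroup.zpow_mem _ hzy l))
    · rw [zpow_natCast]; exact hηpy
  refine isMetacyclic_of_commutator_le hcl (fun x hx => ?_) hy
  obtain ⟨x1, hx1, x2, hx2, rfl⟩ := hcomm x hx
  exact Subgroup.mul_mem _ (Subgroup.zpowers_le.2 hηy hx1) (Subgroup.zpowers_le.2 hzy hx2)

end IsFrame

/-! ### Order `p ^ 3` and the assembly of the cases -/

lemma card_commutator_of_card_eq_prime_cube {G : Type*} [Group G] [Finite G] {p : ℕ}
    (hp : p.Prime) (hG : ¬ ∀ x y : G, x * y = y * x) (hc : Nat.card G = p ^ 3) :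
    Nat.card (commutator G) = p := by
  have := Fact.mk hp
  have hpG : IsPGroup p G := IsPGroup.of_card hc
  have : Nontrivial G := by
    by_contra h
    rw [not_nontrivial_iff_subsingleton] at h
    exact hG fun x y => Subsingleton.elim _ _
  have hZ := hpG.center_nontrivial
  obtain ⟨k, hk, hk2⟩ := (Nat.dvd_prime_pow hp).1
    (hc ▸ Subgroup.card_subgroup_dvd_card (Subgroup.center G))
  have hk0 : k ≠ 0 := by
    rintro rfl
    rw [pow_zero] at hk2
    have := Finite.one_lt_card (α := Subgroup.center G)
    omega
  have hmul := (Subgroup.center G).card_mul_index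
  have hncyc : ¬ IsCyclic (G ⧸ Subgroup.center G) := fun h =>
    hG ((QuotientGroup.mk' (Subgroup.center G)).isMulCommutative_of_isCyclic_of_ker_le_center
      (by rw [QuotientGroup.ker_mk'])).is_comm.comm
  have hi : (Subgroup.center G).index = p ^ (3 - k) := by
    rw [hk2, hc, ← Nat.add_sub_cancel' hk, pow_add] at hmul
    simpa using Nat.eq_of_mul_eq_mul_left (pow_pos hp.pos k) hmul
  -- A larger center would have index dividing `p`, making the central quotient cyclic and `G`
  -- abelian.
  have hk1 : k = 1 := by
    by_contra hk1
    apply hncyc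
    apply isCyclic_of_card_dvd_prime (p := p)
    change (Subgroup.center G).index ∣ p
    rw [hi]
    exact (pow_dvd_pow p (by omega : 3 - k ≤ 1)).trans (by rw [pow_one])
  subst hk1
  refine card_commutator_eq_of_le hp hG (N := Subgroup.center G) ?_ (by rw [hk2, pow_one])
  rw [← Subgroup.Normal.quotient_commutative_iff_commutator_le]
  exact IsPGroup.isMulCommutative_of_card_eq_prime_sq (p := p) hi

theorem mainTheorem3 {p : ℕ} (hp : p.Prime) (hp2 : 2 < p)
    {G : Type*} [Group G] [Finite G] (hG : IsPGroup p G)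
    (hnonab : ¬ ∀ x y : G, x * y = y * x)
    (hcyc : ∃ C : Subgroup G, IsCyclic C ∧ C.index = p ^ 2) :
    IsMetacyclic G ∨
      Nat.card (commutator G) = p ∨
      (IsElementaryAbelian p (commutator G) ∧ Nat.card (commutator G) = p ^ 2 ∧
        Group.rank G = 2) := by
  have := Fact.mk hp
  have hodd : Odd p := hp.odd_of_ne_two (by omega)
  obtain ⟨C, hC, hi⟩ := hcyc
  obtain ⟨c, rfl⟩ := C.isCyclic_iff_exists_zpowers_eq_top.1 hC
  obtain ⟨n, hn⟩ := (IsPGroup.iff_orderOf.1 hG) c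
  have hcard : Nat.card G = p ^ (n + 2) := by
    rw [← (Subgroup.zpowers c).card_mul_index, hi, Nat.card_zpowers, hn, pow_add]
  match n, hn, hcard with
  | 0, _, hcard =>
    exact (hnonab (IsPGroup.isMulCommutative_of_card_eq_prime_sq hcard).is_comm.comm).elim
  | 1, _, hcard => exact Or.inr (Or.inl (card_commutator_of_card_eq_prime_cube hp hnonab hcard))
  | m + 2, hn, hcard =>
    obtain ⟨M, hMc, hCM⟩ := Sylow.exists_subgroup_card_pow_succ (p := p) (n := m + 2) (G := G)
      (by rw [hcard]; exact pow_dvd_pow p (by omega)) (H := Subgroup.zpowers c)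
      (by rw [Nat.card_zpowers, hn])
    have hMi : M.index = p := by
      have := M.card_mul_index
      rw [hMc, hcard, pow_succ _ (m + 3)] at this
      exact Nat.eq_of_mul_eq_mul_left (pow_pos hp.pos _) this
    have hMn : M.Normal := by
      apply Subgroup.normal_of_index_eq_minFac_card
      rw [hMi, hcard, hp.pow_minFac (by omega)]
    by_cases hMcyc : IsCyclic M
    · exact Or.inl ⟨M, hMn, hMcyc, isCyclic_of_prime_card (p := p) hMi⟩
    have hcM : c ∈ M := hCM (Subgroup.mem_zpowers c)
    have ho : orderOf (⟨c, hcM⟩ : M) = p ^ (m + 2) := by rw [Subgroup.orderOf_mk, hn]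
    obtain ⟨b, hbc, hbp, ⟨a, ha⟩, hbM⟩ := exists_complement_of_index_prime hp hodd hMcyc ho (by
      have := (Subgroup.zpowers (⟨c, hcM⟩ : M)).card_mul_index
      rw [Nat.card_zpowers, ho, hMc, pow_succ _ (m + 2)] at this
      exact Nat.eq_of_mul_eq_mul_left (pow_pos hp.pos _) this)
    have hM (x : G) (hx : x ∈ M) : ∃ i j : ℤ, x = c ^ i * (b : G) ^ j := by
      obtain ⟨i, j, hij⟩ := hbM ⟨x, hx⟩
      exact ⟨i, j, by simpa using congrArg (Subtype.val) hij⟩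
    obtain ⟨g, hg⟩ : ∃ g, g ∉ M := by
      by_contra! hall
      have hMt : M = ⊤ := eq_top_iff.2 fun x _ => hall x
      rw [hMt, Subgroup.index_top] at hMi
      exact hp.ne_one hMi.symm
    have hF : IsFrame p m c (b : G) g :=
      { orderOf_eq := hn
        notMem := by
          intro hb
          obtain ⟨i, hi⟩ := Subgroup.mem_zpowers_iff.1 hb
          exact hbc (Subgroup.mem_zpowers_iff.2 ⟨i, Subtype.ext (by simpa using hi)⟩)
        pow_eq_one := by simpa using congrArg (Subtype.val) hbp
        conj := ⟨a, by simpa using congrArg (Subtype.val) ha⟩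
        conj_left := hM _ (hMn.conj_mem c hcM g)
        conj_right := hM _ (hMn.conj_mem b b.2 g)
        pow_mem := hM _ (Subgroup.pow_mem_of_index_prime hMi g)
        closure_eq_top := by
          rw [eq_top_iff]
          intro x _
          obtain ⟨y, hy, l, rfl⟩ := Subgroup.exists_mul_zpow_of_index_prime hp hMi hg x
          obtain ⟨i, j, rfl⟩ := hM y hy
          have h1 : ∀ x ∈ ({c, (b : G), g} : Set G), x ∈ Subgroup.closure {c, (b : G), g} :=
            fun x hx => Subgroup.subset_closure hx
          exact Subgroup.mul_mem _ (Subgroup.mul_mem _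
            (Subgroup.zpow_mem _ (h1 c (by simp)) _) (Subgroup.zpow_mem _ (h1 b (by simp)) _))
            (Subgroup.zpow_mem _ (h1 g (by simp)) _) }
    obtain ⟨i, j, hij⟩ := hF.conj_left
    obtain ⟨k, hk⟩ := hF.dvd_sub_one hp hodd hG hij
    by_cases hj : (p : ℤ) ∣ j
    · refine (hF.commutator_le_of_normal_zpowers hp hodd hG hij hj hi).imp_right fun hle => ?_
      exact Or.inl (card_commutator_eq_of_le hp hnonab hle
        (by rw [Nat.card_zpowers, hF.orderOf_socle hp]))
    by_cases hh : (c ^ ((p : ℤ) * k) * (b : G) ^ j) ^ p = 1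
    · exact Or.inr (hF.commutator_of_pow_eq_one hp hodd hG hnonab hij hk hj hh)
    · exact Or.inl (hF.isMetacyclic_of_pow_ne_one hp hodd hG hij hk hj hh)
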